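/- Let $\mathbb{H}$ be a complex Hilbert space and $T$ a bounded linear operator on $\mathbb{H}$. Write $w(S)=\sup\{|\langle Sx,x\rangle| : x\in\mathbb{H},\ \|x\|=1\}$ for the numerical radius of a bounded operator $S$ (with $w(S)=0$ if $\mathbb{H}=\{0\}$), and $\|S\|$ for its operator norm. Let $T=U|T|$ be the polar decomposition of $T$, where $|T|=(T^*T)^{1/2}$ and $U$ is the partial isometry with $\ker U=\ker T$. For $t\in[0,1]$ let \[\widetilde{T_t}=|T|^{t}\,U\,|T|^{1-t},\] where $|T|^0$ is understood as $U^*U$, be the $t$-Aluthge transform of $T$, and let $\widetilde{T}=|T|^{1/2}U|T|^{1/2}$ be the Aluthge transform. Put $P=T^*T+TT^*$. Then the minimum below is attained, and \[ w^4(T)\leq \frac{1}{16}\, \min_{t\in [0,1]}\left(w\big(\widetilde{T_t}^{\,2}\big)+\|T\|\,\|\widetilde{T_t}\|\right)^2+\frac{1}{8}\,w(T^2P+PT^2)+\frac{1}{16}\|P\|^2.\] In particular (the case $t=\frac12$), \[ w^4(T)\leq \frac{1}{16}\left(w\big(\widetilde{T}^{\,2}\big)+\|T\|\,\|\widetilde{T}\|\right)^2+\frac{1}{8}\,w(T^2P+PT^2)+\frac{1}{16}\|P\|^2.\]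 Moreover, for the operator $T=\begin{pmatrix}0&2&0\\0&0&3\\0&0&0\end{pmatrix}$ on $\mathbb{C}^3$ (with the Euclidean norm) the upper bound for $w(T)$ given by the first inequality is strictly smaller than Yamazaki's bound: \[ \left(\frac{1}{16}\, \min_{t\in [0,1]}\left(w\big(\widetilde{T_t}^{\,2}\big)+\|T\|\,\|\widetilde{T_t}\|\right)^2+\frac{1}{8}\,w(T^2P+PT^2)+\frac{1}{16}\|P\|^2\right)^{1/4} < \frac12\left(\|T\|+w(\widetilde{T})\right).\] -/

import Mathlib

namespace NumRadius

section General

variable {H : Type*} [NormedAddCommGroup H] [InnerProductSpace ℂ H]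

/-- The numerical range `W(T)` of a bounded operator. (Mathlib's inner product is linear in the
second variable, so `⟪x, T x⟫` is the usual `⟨T x, x⟩` of the convention linear in the first.) -/
def numericalRange (T : H →L[ℂ] H) : Set ℂ :=
  {z | ∃ x : H, ‖x‖ = 1 ∧ z = inner ℂ x (T x)}

/-- The numerical radius `w(T) = sup {|z| : z ∈ W(T)}`. -/
noncomputable def numericalRadius (T : H →L[ℂ] H) : ℝ :=
  sSup ((fun z : ℂ => ‖z‖) '' numericalRange T)

/-- The set whose supremum defines the numerical radius is bounded above. -/
theorem bddAbove_norm_numericalRange (T : H →L[ℂ] H) :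
    BddAbove ((fun z : ℂ => ‖z‖) '' numericalRange T) := by
  refine ⟨‖T‖, ?_⟩
  rintro _ ⟨z, ⟨x, hx, rfl⟩, rfl⟩
  calc ‖inner ℂ x (T x)‖ ≤ ‖x‖ * ‖T x‖ := norm_inner_le_norm _ _
    _ ≤ ‖T‖ := by simpa [hx] using T.le_opNorm x

/-- A partial isometry: an operator that is isometric on the orthogonal complement of its
kernel. -/
def IsPartialIsometry (U : H →L[ℂ] H) : Prop :=
  ∀ x ∈ (LinearMap.ker U.toLinearMap)ᗮ, ‖U x‖ = ‖x‖

end General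

section Polar

variable {H : Type*} [NormedAddCommGroup H] [InnerProductSpace ℂ H] [CompleteSpace H]

/-- `U` is the partial isometry in the polar decomposition of `T`: `T = U |T|` with
`ker U = ker T`, where `|T| = (T* T)^(1/2)` is `CFC.abs T`. -/
structure IsPolarPart (T U : H →L[ℂ] H) : Prop where
  isPartialIsometry : IsPartialIsometry U
  eq_mul_abs : T = U * CFC.abs T
  ker_eq : LinearMap.ker U.toLinearMap = LinearMap.ker T.toLinearMap

theorem norm_abs_apply (T : H →L[ℂ] H) (x : H) : ‖CFC.abs T x‖ = ‖T x‖ := by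
  have hA : ContinuousLinearMap.adjoint (CFC.abs T) = CFC.abs T :=
    (IsSelfAdjoint.of_nonneg (CFC.abs_nonneg T)).adjoint_eq
  have h1 : inner ℂ (CFC.abs T x) (CFC.abs T x) = inner ℂ (T x) (T x) := by
    have h2 : CFC.abs T (CFC.abs T x) = ContinuousLinearMap.adjoint T (T x) :=
      DFunLike.congr_fun (CFC.abs_mul_abs T) x
    rw [← ContinuousLinearMap.adjoint_inner_right (CFC.abs T), hA, h2,
      ContinuousLinearMap.adjoint_inner_right]
  rw [@norm_eq_sqrt_re_inner ℂ, h1, ← @norm_eq_sqrt_re_inner ℂ]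

theorem orthogonal_closure_range_abs (T : H →L[ℂ] H) :
    (LinearMap.range (CFC.abs T).toLinearMap).topologicalClosureᗮ
      = LinearMap.ker T.toLinearMap := by
  have hA : ContinuousLinearMap.adjoint (CFC.abs T) = CFC.abs T :=
    (IsSelfAdjoint.of_nonneg (CFC.abs_nonneg T)).adjoint_eq
  rw [Submodule.orthogonal_closure, ContinuousLinearMap.orthogonal_range, hA]
  ext x
  simp only [LinearMap.mem_ker, ContinuousLinearMap.coe_coe]
  rw [← norm_eq_zero, norm_abs_apply, norm_eq_zero]

/-- Existence and uniqueness of the polar decomposition. -/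
theorem existsUnique_isPolarPart (T : H →L[ℂ] H) : ∃! U : H →L[ℂ] H, IsPolarPart T U := by
  set A := CFC.abs T with hAdef
  set K := (LinearMap.range A.toLinearMap).topologicalClosure with hK
  have hmem : ∀ x, A x ∈ K := fun x => Submodule.le_topologicalClosure _ ⟨x, rfl⟩
  have hKo : Kᗮ = LinearMap.ker T.toLinearMap := orthogonal_closure_range_abs T
  have hKc : IsClosed (K : Set H) := Submodule.isClosed_topologicalClosure _
  have : CompleteSpace K := hKc.completeSpace_coe
  have hKoo : Kᗮᗮ = K := Submodule.orthogonal_orthogonal K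
  have ext_K : ∀ {p : H → Prop}, IsClosed {y | p y} → (∀ x, p (A x)) → ∀ y ∈ K, p y := by
    intro p hp h y hy
    have hsub : closure (Set.range A) ⊆ {y | p y} :=
      closure_minimal (by rintro _ ⟨x, rfl⟩; exact h x) hp
    have hy' : y ∈ closure (LinearMap.range A.toLinearMap : Set H) := by
      rw [← Submodule.topologicalClosure_coe]; exact hy
    exact hsub hy'
  let e : H →ₗ[ℂ] K := A.toLinearMap.codRestrict K hmem
  have hdense : DenseRange e := by
    intro y
    rw [closure_subtype]
    have : (Subtype.val '' Set.range e : Set H) = Set.range A := by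
      rw [← Set.range_comp]; rfl
    rw [this]
    have hy' : (y : H) ∈ closure (LinearMap.range A.toLinearMap : Set H) := by
      rw [← Submodule.topologicalClosure_coe]; exact y.2
    exact hy'
  have hnorm : ∃ C, ∀ x, ‖T.toLinearMap x‖ ≤ C * ‖e x‖ :=
    ⟨1, fun x => by
      have : ‖e x‖ = ‖T x‖ := norm_abs_apply T x
      rw [this, one_mul]; rfl⟩
  let S : K →L[ℂ] H := T.toLinearMap.extendOfNorm e
  let U : H →L[ℂ] H := S ∘L K.orthogonalProjectionOnto
  have hUA : ∀ x, U (A x) = T x := by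
    intro x
    have h1 : K.orthogonalProjectionOnto (A x) = e x :=
      Submodule.orthogonalProjectionOnto_mem_subspace_eq_self (K := K) (e x)
    change S (K.orthogonalProjectionOnto (A x)) = T x
    rw [h1]
    exact LinearMap.extendOfNorm_eq hdense hnorm x
  have hUK : ∀ y ∈ K, ‖U y‖ = ‖y‖ := by
    refine ext_K (isClosed_eq (by fun_prop) (by fun_prop)) ?_
    intro x
    rw [hUA, hAdef, norm_abs_apply]
  have hU0 : ∀ y ∈ Kᗮ, U y = 0 := by
    intro y hy
    change S (K.orthogonalProjectionOnto y) = 0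
    rw [Submodule.orthogonalProjectionOnto_eq_zero_iff.2 hy, map_zero]
  have hker : LinearMap.ker U.toLinearMap = LinearMap.ker T.toLinearMap := by
    rw [← hKo]
    apply le_antisymm
    · intro y hy
      have hy' : U y = 0 := hy
      obtain ⟨a, ha, b, hb, rfl⟩ := Submodule.exists_add_mem_mem_orthogonal (K := K) y
      rw [map_add, hU0 b hb, add_zero] at hy'
      have : ‖a‖ = 0 := by rw [← hUK a ha, hy', norm_zero]
      rw [norm_eq_zero.1 this, zero_add]
      exact hb
    · intro y hy
      exact hU0 y hy
  refine ⟨U, ⟨?_, ?_, hker⟩, ?_⟩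
  · intro x hx
    rw [hker, ← hKo, hKoo] at hx
    exact hUK x hx
  · ext x
    exact (hUA x).symm
  · rintro V ⟨-, hV, hVk⟩
    have hVA : ∀ x, V (A x) = U (A x) := fun x => by
      rw [hUA]; exact (DFunLike.congr_fun hV x).symm
    have hVK : ∀ y ∈ K, V y = U y :=
      ext_K (isClosed_eq (by fun_prop) (by fun_prop)) hVA
    ext y
    obtain ⟨a, ha, b, hb, rfl⟩ := Submodule.exists_add_mem_mem_orthogonal (K := K) y
    have hb' : V b = 0 := by
      have : b ∈ LinearMap.ker V.toLinearMap := by rw [hVk, ← hKo]; exact hb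
      exact this
    rw [map_add, map_add, hVK a ha, hb', hU0 b hb]

/-- The partial isometry `U` in the polar decomposition `T = U |T|`, `ker U = ker T`. -/
noncomputable def polarPart (T : H →L[ℂ] H) : H →L[ℂ] H :=
  (existsUnique_isPolarPart T).choose

theorem isPolarPart_polarPart (T : H →L[ℂ] H) : IsPolarPart T (polarPart T) :=
  (existsUnique_isPolarPart T).choose_spec.1

/-- The power `|T|^s` for `s ≥ 0`, with the convention that `|T|^0` is `U* U`, where `U` is the
partial isometry in the polar decomposition of `T`. For `s ≠ 0` it is the real power given by the
continuous functional calculus. -/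
noncomputable def absPow (T : H →L[ℂ] H) (s : ℝ) : H →L[ℂ] H :=
  if s = 0 then star (polarPart T) * polarPart T else CFC.abs T ^ s

/-- The `t`-Aluthge transform `|T|^t U |T|^(1-t)`, for `t ∈ [0,1]`. -/
noncomputable def tAluthge (T : H →L[ℂ] H) (t : ℝ) : H →L[ℂ] H :=
  absPow T t * polarPart T * absPow T (1 - t)

/-- The Aluthge transform `|T|^(1/2) U |T|^(1/2)`. -/
noncomputable def aluthge (T : H →L[ℂ] H) : H →L[ℂ] H :=
  CFC.abs T ^ (1 / 2 : ℝ) * polarPart T * CFC.abs T ^ (1 / 2 : ℝ)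

/-- The operator `P = T* T + T T*`. -/
noncomputable def opP (T : H →L[ℂ] H) : H →L[ℂ] H :=
  star T * T + T * star T

/-- The set of the values `(w(T̃_t ^ 2) + ‖T‖ ‖T̃_t‖) ^ 2`, for `t ∈ [0,1]`. -/
def aluthgeValues (T : H →L[ℂ] H) : Set ℝ :=
  (fun t : ℝ => (numericalRadius (tAluthge T t ^ 2) + ‖T‖ * ‖tAluthge T t‖) ^ 2) ''
    Set.Icc (0 : ℝ) 1

end Polar

/-- The operator on the Hilbert space `ℂ³` with matrix `(0 2 0; 0 0 3; 0 0 0)`. -/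
noncomputable def exampleOp : EuclideanSpace ℂ (Fin 3) →L[ℂ] EuclideanSpace ℂ (Fin 3) :=
  Matrix.toEuclideanCLM (n := Fin 3) (𝕜 := ℂ) !![0, 2, 0; 0, 0, 3; 0, 0, 0]

end NumRadius

namespace NumRadius

/-! ### Numerical radius, approximate eigenvectors, and the norm of a symmetric product -/

section NumericalRadius

open Filter Topology

variable {H K : Type*} [NormedAddCommGroup H] [InnerProductSpace ℂ H]
  [NormedAddCommGroup K] [InnerProductSpace ℂ K]

/-! The numerical radius is `w(T) = sup ‖Re (cT)‖` over unimodular `c`. Put `D = cT + (cT)*`. Then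
`D² = Q + P` with `Q = c²T² + (c²T²)*`, and `‖D‖⁴ = ‖D²‖²`. Expanding `‖Qx + Px‖²` gives three
terms, controlled by `‖Q‖ ≤ 2 w(T²)`, by the cross term `Re ⟨c²(T²P + PT²)x, x⟩`, and by `‖P‖`.
Hence `16 w(T)⁴ ≤ 4 w(T²)² + 2 w(T²P + PT²) + ‖P‖²` (`numericalRadius_pow_four_le`).

The Aluthge transform enters through `2 w(XY) ≤ w(YX) + ‖X‖ ‖Y‖` (`numericalRadius_mul_le`). With `X
= U|T|^(1-t)` and `Y = T̃_t |T|^t` one has `XY = T²`, `YX = T̃_t²` and `‖X‖ ‖Y‖ ≤ ‖T‖ ‖T̃_t‖`. The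
product inequality comes from factoring `XY + (XY)* = RC` through `H ⊕ H` and comparing with the
numerical radius of the block operator `CR`.

The minimum is attained because `t ↦ T̃_t` is strongly continuous on `[0,1]`, endpoints included.
The norm and the numerical radius, being suprema of functions continuous in `t`, are then lower
semicontinuous on a compact interval (`exists_isLeast_aluthgeValues`).

For the matrix, the value at `t = 1` already beats Yamazaki's bound. -/

theorem numericalRadius_nonneg (T : H →L[ℂ] H) : 0 ≤ numericalRadius T := by
  refine Real.sSup_nonneg ?_
  rintro _ ⟨z, -, rfl⟩
  exact norm_nonneg z

theorem norm_inner_apply_le_of_norm_eq_one (T : H →L[ℂ] H) {x : H} (hx : ‖x‖ = 1) :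
    ‖inner ℂ x (T x)‖ ≤ numericalRadius T :=
  le_csSup (bddAbove_norm_numericalRange T) ⟨_, ⟨x, hx, rfl⟩, rfl⟩

theorem norm_inner_apply_le (T : H →L[ℂ] H) (x : H) :
    ‖inner ℂ x (T x)‖ ≤ numericalRadius T * ‖x‖ ^ 2 := by
  rcases eq_or_ne x 0 with rfl | hx
  · simp
  have hx' : 0 < ‖x‖ := norm_pos_iff.2 hx
  have h := norm_inner_apply_le_of_norm_eq_one T (norm_smul_inv_norm (𝕜 := ℂ) hx)
  rw [map_smul, inner_smul_left, inner_smul_right, norm_mul, norm_mul] at h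
  simp only [RCLike.norm_conj, norm_inv, Complex.coe_algebraMap, Complex.norm_real, norm_norm] at h
  rw [← mul_assoc, ← mul_inv, ← sq, inv_mul_le_iff₀ (by positivity)] at h
  linarith

theorem numericalRadius_le {T : H →L[ℂ] H} {M : ℝ} (hM : 0 ≤ M)
    (h : ∀ x, ‖x‖ = 1 → ‖inner ℂ x (T x)‖ ≤ M) : numericalRadius T ≤ M := by
  refine Real.sSup_le ?_ hM
  rintro _ ⟨_, ⟨x, hx, rfl⟩, rfl⟩
  exact h x hx

theorem numericalRadius_le_norm (T : H →L[ℂ] H) : numericalRadius T ≤ ‖T‖ :=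
  numericalRadius_le (norm_nonneg T) fun x hx => by
    calc ‖inner ℂ x (T x)‖ ≤ ‖x‖ * ‖T x‖ := norm_inner_le_norm _ _
      _ ≤ ‖T‖ := by simpa [hx] using T.le_opNorm x

theorem exists_norm_eq_one_mul_eq_norm (z : ℂ) : ∃ c : ℂ, ‖c‖ = 1 ∧ c * z = ‖z‖ := by
  rcases eq_or_ne z 0 with rfl | hz
  · exact ⟨1, by simp⟩
  have hz' : (‖z‖ : ℂ) ≠ 0 := by simpa using hz
  refine ⟨starRingEnd ℂ z / ‖z‖, by simp [hz], ?_⟩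
  rw [div_mul_eq_mul_div, Complex.conj_mul', sq, mul_div_assoc, div_self hz', mul_one]

theorem opNorm_le_of_abs_re_inner_le {S : H →L[ℂ] H} (hS : S.toLinearMap.IsSymmetric) {M : ℝ}
    (hM : 0 ≤ M) (h : ∀ x, |(inner ℂ x (S x)).re| ≤ M * ‖x‖ ^ 2) : ‖S‖ ≤ M := by
  rw [S.norm_eq_iSup_rayleighQuotient hS]
  refine ciSup_le fun x => ?_
  rw [ContinuousLinearMap.rayleighQuotient, abs_div, abs_sq]
  refine div_le_of_le_mul₀ (sq_nonneg _) hM ?_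
  rw [ContinuousLinearMap.reApplyInnerSelf_apply, inner_re_symm]
  exact h x

/-- Approximate eigenvectors for `‖S‖` or `-‖S‖`: the norm of a symmetric operator is the supremum
of its absolute Rayleigh quotients, and a unit vector that nearly reaches it is nearly an
eigenvector. -/
theorem exists_norm_sub_smul_le {S : H →L[ℂ] H} (hS : S.toLinearMap.IsSymmetric)
    (h0 : 0 < ‖S‖) {δ : ℝ} (hδ : 0 < δ) :
    ∃ (x : H) (a : ℝ), ‖x‖ = 1 ∧ |a| = ‖S‖ ∧ ‖S x - (a : ℂ) • x‖ ≤ δ := by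
  -- This slack is chosen so that `‖Sx - ax‖² ≤ 2‖S‖² - 2‖S‖(‖S‖ - δ²/(2‖S‖)) = δ²`.
  have hlt : ‖S‖ - δ ^ 2 / (2 * ‖S‖) < ⨆ x, |S.rayleighQuotient x| := by
    rw [← S.norm_eq_iSup_rayleighQuotient hS]
    have : 0 < δ ^ 2 / (2 * ‖S‖) := by positivity
    linarith
  have key : ∃ x : H, ‖x‖ = 1 ∧ ‖S‖ - δ ^ 2 / (2 * ‖S‖) ≤ |(inner ℂ x (S x)).re| := by
    by_contra! hcon
    obtain ⟨y, hy⟩ := exists_lt_of_lt_ciSup hlt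
    -- At `y = 0` the quotient is `0` by convention. The threshold is then negative, so any unit
    -- vector contradicts `hcon`.
    rcases eq_or_ne y 0 with rfl | hy0
    · rw [ContinuousLinearMap.rayleighQuotient_apply_zero, abs_zero] at hy
      obtain ⟨z, hz⟩ : ∃ z : H, z ≠ 0 := by
        by_contra! hz
        apply h0.ne'
        rw [norm_eq_zero]
        ext z
        simp [hz z]
      have := hcon _ (norm_smul_inv_norm (𝕜 := ℂ) hz)
      exact absurd (this.trans hy) (not_lt.2 (abs_nonneg _))
    · have h1 := hcon _ (norm_smul_inv_norm (𝕜 := ℂ) hy0)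
      have hc : ((‖y‖ : ℂ)⁻¹) ≠ 0 := by simpa using hy0
      have h2 := S.rayleigh_smul y hc
      rw [← h2, ContinuousLinearMap.rayleighQuotient,
        ContinuousLinearMap.reApplyInnerSelf_apply, inner_re_symm] at hy
      have h3 : ‖(‖y‖ : ℂ)⁻¹ • y‖ = 1 := norm_smul_inv_norm (𝕜 := ℂ) hy0
      rw [h3, one_pow, div_one] at hy
      exact absurd (hy.trans h1) (lt_irrefl _)
  obtain ⟨x, hx, hxS⟩ := key
  have hle : ‖S x‖ ≤ ‖S‖ := by simpa [hx] using S.le_opNorm x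
  have main : ∀ a : ℝ, |a| = ‖S‖ → ‖S‖ - δ ^ 2 / (2 * ‖S‖) ≤ (a / ‖S‖) * (inner ℂ x (S x)).re →
      ‖S x - (a : ℂ) • x‖ ≤ δ := by
    intro a ha h
    refine le_of_sq_le_sq ?_ hδ.le
    have e1 : ‖S x - (a : ℂ) • x‖ ^ 2
        = ‖S x‖ ^ 2 - 2 * (a * (inner ℂ x (S x)).re) + ‖S‖ ^ 2 := by
      rw [@norm_sub_sq ℂ, inner_smul_right, norm_smul, hx, Complex.norm_real, Real.norm_eq_abs, ha,
        mul_one]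
      have e0 : (inner ℂ (S x) x).re = (inner ℂ x (S x)).re :=
        inner_re_symm (𝕜 := ℂ) (S x) x
      simp [e0]
    have e2 : ‖S‖ * (‖S‖ - δ ^ 2 / (2 * ‖S‖)) ≤ a * (inner ℂ x (S x)).re := by
      calc _ ≤ ‖S‖ * ((a / ‖S‖) * (inner ℂ x (S x)).re) := by gcongr
        _ = _ := by field_simp
    have e3 : ‖S‖ * (‖S‖ - δ ^ 2 / (2 * ‖S‖)) = ‖S‖ ^ 2 - δ ^ 2 / 2 := by field_simp
    have e4 : ‖S x‖ ^ 2 ≤ ‖S‖ ^ 2 := by gcongr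
    rw [e1]
    linarith
  rcases le_total 0 (inner ℂ x (S x)).re with h | h
  · refine ⟨x, ‖S‖, hx, abs_norm S, main _ (abs_norm S) ?_⟩
    rw [abs_of_nonneg h] at hxS
    rwa [div_self h0.ne', one_mul]
  · refine ⟨x, -‖S‖, hx, by simp, main _ (by simp) ?_⟩
    rw [abs_of_nonpos h] at hxS
    rwa [neg_div, div_self h0.ne', neg_one_mul]

/-- A substitute for `r(RC) = r(CR) ≤ w(CR)`, for self-adjoint `RC`. -/
theorem opNorm_comp_le_of_norm_inner_comp_le (R : K →L[ℂ] H) (C : H →L[ℂ] K)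
    (hS : (R ∘L C).toLinearMap.IsSymmetric) {M : ℝ} (hM : 0 ≤ M)
    (h : ∀ z, ‖inner ℂ z (C (R z))‖ ≤ M * ‖z‖ ^ 2) : ‖R ∘L C‖ ≤ M := by
  by_contra! hlt
  set S := R ∘L C with hSdef
  have h0 : 0 < ‖S‖ := hM.trans_lt hlt
  -- If `RCx ≈ ax` then `CR(Cx) ≈ a Cx`, so `Cx` tests the quadratic form of `CR` at nearly `a`. It
  -- does not degenerate, since `R(Cx)` is close to `ax`. As `δ → 0` this leaves `(‖S‖ - M)‖S‖ ≤ 0`.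
  have key : ∀ δ : ℝ, 0 < δ → (‖S‖ - M) * (‖S‖ - δ) ≤ ‖R‖ * (‖C‖ * δ) := by
    intro δ hδ
    obtain ⟨x, a, hx, ha, hxa⟩ := exists_norm_sub_smul_le hS h0 hδ
    have ha' : ‖(a : ℂ)‖ = ‖S‖ := by rw [Complex.norm_real, Real.norm_eq_abs, ha]
    have h1 : ‖S‖ - δ ≤ ‖R‖ * ‖C x‖ := by
      have e1 : ‖(a : ℂ) • x‖ = ‖S‖ := by rw [norm_smul, ha', hx, mul_one]
      have e2 : ‖S x‖ ≤ ‖R‖ * ‖C x‖ := R.le_opNorm (C x)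
      have e3 := norm_sub_norm_le ((a : ℂ) • x) (S x)
      rw [norm_sub_rev, e1] at e3
      linarith
    have h2 : (‖S‖ - M) * ‖C x‖ ≤ ‖C‖ * δ := by
      rcases eq_or_ne (C x) 0 with h0 | h0
      · rw [h0, norm_zero, mul_zero]; positivity
      have hpos : 0 < ‖C x‖ := norm_pos_iff.2 h0
      have e1 : (a : ℂ) * inner ℂ (C x) (C x)
          = inner ℂ (C x) (C (R (C x))) - inner ℂ (C x) (C (S x - (a : ℂ) • x)) := by
        rw [map_sub, map_smul, inner_sub_right, inner_smul_right, hSdef,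
          ContinuousLinearMap.comp_apply]
        ring
      have e2 : ‖S‖ * ‖C x‖ ^ 2 ≤ M * ‖C x‖ ^ 2 + ‖C x‖ * (‖C‖ * δ) := by
        calc ‖S‖ * ‖C x‖ ^ 2 = ‖(a : ℂ) * inner ℂ (C x) (C x)‖ := by
              rw [norm_mul, ha', inner_self_eq_norm_sq_to_K]; simp
          _ ≤ ‖inner ℂ (C x) (C (R (C x)))‖ + ‖inner ℂ (C x) (C (S x - (a : ℂ) • x))‖ := by
              rw [e1]; exact norm_sub_le _ _
          _ ≤ M * ‖C x‖ ^ 2 + ‖C x‖ * (‖C‖ * δ) := by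
              refine add_le_add (h _) ((norm_inner_le_norm _ _).trans ?_)
              gcongr
              exact (C.le_opNorm _).trans (by gcongr)
      refine le_of_mul_le_mul_right ?_ hpos
      linarith
    calc (‖S‖ - M) * (‖S‖ - δ) ≤ (‖S‖ - M) * (‖R‖ * ‖C x‖) :=
          mul_le_mul_of_nonneg_left h1 (sub_pos.2 hlt).le
      _ = ‖R‖ * ((‖S‖ - M) * ‖C x‖) := by ring
      _ ≤ ‖R‖ * (‖C‖ * δ) := by gcongr
  have lim : (‖S‖ - M) * (‖S‖ - 0) ≤ ‖R‖ * (‖C‖ * 0) := by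
    refine le_of_tendsto_of_tendsto (b := 𝓝[>] (0 : ℝ))
      (f := fun δ => (‖S‖ - M) * (‖S‖ - δ)) (g := fun δ => ‖R‖ * (‖C‖ * δ)) ?_ ?_ ?_
    · exact ((by fun_prop : Continuous fun δ : ℝ => (‖S‖ - M) * (‖S‖ - δ)).tendsto 0).mono_left
        nhdsWithin_le_nhds
    · exact ((by fun_prop : Continuous fun δ : ℝ => ‖R‖ * (‖C‖ * δ)).tendsto 0).mono_left
        nhdsWithin_le_nhds
    · filter_upwards [self_mem_nhdsWithin] with δ hδ using key δ hδ
  have : 0 < (‖S‖ - M) * ‖S‖ := mul_pos (sub_pos.2 hlt) h0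
  simp only [sub_zero, mul_zero] at lim
  linarith

theorem numericalRadius_smul_of_norm_eq_one {c : ℂ} (hc : ‖c‖ = 1) (T : H →L[ℂ] H) :
    numericalRadius (c • T) = numericalRadius T := by
  have key : ∀ {c : ℂ}, ‖c‖ = 1 → ∀ T : H →L[ℂ] H, numericalRadius (c • T) ≤ numericalRadius T :=
    fun {c} hc T => numericalRadius_le (numericalRadius_nonneg T) fun x hx => by
      rw [smul_apply, inner_smul_right, norm_mul, hc, one_mul]
      exact norm_inner_apply_le_of_norm_eq_one T hx
  refine le_antisymm (key hc T) ?_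
  have hc0 : c ≠ 0 := by rintro rfl; simp at hc
  have h := key (c := c⁻¹) (by rw [norm_inv, hc, inv_one]) (c • T)
  rwa [smul_smul, inv_mul_cancel₀ hc0, one_smul] at h

end NumericalRadius

/-! ### The product inequality and the fourth-power bound -/

section Products

variable {H : Type*} [NormedAddCommGroup H] [InnerProductSpace ℂ H] [CompleteSpace H]

open ContinuousLinearMap in
theorem isSymmetric_add_adjoint (A : H →L[ℂ] H) : (A + adjoint A).toLinearMap.IsSymmetric := by
  rw [← isSelfAdjoint_iff_isSymmetric]
  exact IsSelfAdjoint.add_star_self A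

theorem re_inner_add_adjoint_apply (A : H →L[ℂ] H) (x : H) :
    inner ℂ x ((A + ContinuousLinearMap.adjoint A) x) = ((2 * (inner ℂ x (A x)).re : ℝ) : ℂ) := by
  rw [add_apply, inner_add_right, ContinuousLinearMap.adjoint_inner_right,
    ← inner_conj_symm (A x) x, Complex.add_conj]

theorem norm_add_adjoint_le (A : H →L[ℂ] H) :
    ‖A + ContinuousLinearMap.adjoint A‖ ≤ 2 * numericalRadius A := by
  refine opNorm_le_of_abs_re_inner_le (isSymmetric_add_adjoint A)
    (mul_nonneg zero_le_two (numericalRadius_nonneg A)) fun x => ?_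
  rw [re_inner_add_adjoint_apply, Complex.ofReal_re, abs_mul, abs_two, mul_assoc]
  gcongr
  exact (Complex.abs_re_le_norm _).trans (norm_inner_apply_le A x)

/-- For each unit `x` some unimodular `c` rotates `⟨Tx, x⟩` onto the nonnegative half-line, where it
is seen by the real part of `cT`. -/
theorem numericalRadius_le_of_norm_add_adjoint_le {T : H →L[ℂ] H} {M : ℝ} (hM : 0 ≤ M)
    (h : ∀ c : ℂ, ‖c‖ = 1 → ‖c • T + ContinuousLinearMap.adjoint (c • T)‖ ≤ 2 * M) :
    numericalRadius T ≤ M := by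
  refine numericalRadius_le hM fun x hx => ?_
  obtain ⟨c, hc, hcz⟩ := exists_norm_eq_one_mul_eq_norm (inner ℂ x (T x))
  have h1 := re_inner_add_adjoint_apply (c • T) x
  rw [smul_apply, inner_smul_right, hcz, Complex.ofReal_re] at h1
  have h2 : 2 * ‖inner ℂ x (T x)‖ ≤ 2 * M := by
    calc 2 * ‖inner ℂ x (T x)‖
        = ‖inner ℂ x ((c • T + ContinuousLinearMap.adjoint (c • T)) x)‖ := by
          rw [h1, Complex.norm_real, Real.norm_eq_abs, abs_of_nonneg (by positivity)]
      _ ≤ ‖x‖ * ‖(c • T + ContinuousLinearMap.adjoint (c • T)) x‖ := norm_inner_le_norm _ _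
      _ ≤ ‖x‖ * (‖c • T + ContinuousLinearMap.adjoint (c • T)‖ * ‖x‖) := by
          gcongr; exact ContinuousLinearMap.le_opNorm _ _
      _ ≤ 2 * M := by rw [hx, one_mul, mul_one]; exact h c hc
  linarith

open ContinuousLinearMap in
-- The left side is `RC` with row `R = (X, Y*)` and column `C = (Y, X*)ᵀ`. The reversed product `CR`
-- has diagonal blocks `YX` and `(YX)*` and off-diagonal blocks `YY*` and `X*X`; the latter
-- contribute at most `(‖X‖² + ‖Y‖²) ‖u‖ ‖v‖`.
theorem norm_mul_add_adjoint_le (X Y : H →L[ℂ] H) :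
    ‖X * Y + adjoint (X * Y)‖ ≤ numericalRadius (Y * X) + (‖X‖ ^ 2 + ‖Y‖ ^ 2) / 2 := by
  let e := WithLp.prodContinuousLinearEquiv 2 ℂ H H
  let C : H →L[ℂ] WithLp 2 (H × H) := e.symm.toContinuousLinearMap ∘L (Y.prod (adjoint X))
  let R : WithLp 2 (H × H) →L[ℂ] H := (X.coprod (adjoint Y)) ∘L e.toContinuousLinearMap
  have hRC : R ∘L C = X * Y + adjoint (X * Y) := by
    ext x
    have : adjoint (X * Y) = adjoint Y * adjoint X := star_mul X Y
    rw [this]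
    simp [R, C]
  rw [← hRC]
  refine opNorm_comp_le_of_norm_inner_comp_le R C (hRC ▸ isSymmetric_add_adjoint _)
    (add_nonneg (numericalRadius_nonneg _) (by positivity)) fun z => ?_
  obtain ⟨u, v⟩ := z
  have hu := norm_inner_apply_le (Y * X) u
  have hv := norm_inner_apply_le (Y * X) v
  have e1 : inner ℂ (WithLp.toLp 2 (u, v)) (C (R (WithLp.toLp 2 (u, v))))
      = inner ℂ u ((Y * X) u) + inner ℂ u (Y (adjoint Y v)) + inner ℂ v (adjoint X (X u))
        + inner ℂ v (adjoint X (adjoint Y v)) := by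
    simp [R, C, e, inner_add_right]
    ring
  have e2 : ‖inner ℂ v (adjoint X (adjoint Y v))‖ = ‖inner ℂ v ((Y * X) v)‖ := by
    rw [adjoint_inner_right, adjoint_inner_right, norm_inner_symm]; rfl
  have e3 : ‖inner ℂ u (Y (adjoint Y v))‖ ≤ ‖Y‖ ^ 2 * (‖u‖ * ‖v‖) := by
    refine (norm_inner_le_norm _ _).trans ?_
    calc ‖u‖ * ‖Y (adjoint Y v)‖ ≤ ‖u‖ * (‖Y‖ * (‖Y‖ * ‖v‖)) := by
          gcongr
          refine (Y.le_opNorm _).trans ?_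
          gcongr
          simpa using (adjoint Y).le_opNorm v
      _ = _ := by ring
  have e4 : ‖inner ℂ v (adjoint X (X u))‖ ≤ ‖X‖ ^ 2 * (‖u‖ * ‖v‖) := by
    refine (norm_inner_le_norm _ _).trans ?_
    calc ‖v‖ * ‖adjoint X (X u)‖ ≤ ‖v‖ * (‖X‖ * (‖X‖ * ‖u‖)) := by
          gcongr
          refine ((adjoint X).le_opNorm _).trans ?_
          rw [LinearIsometryEquiv.norm_map]
          gcongr
          exact X.le_opNorm u
      _ = _ := by ring
  have e5 : ‖u‖ * ‖v‖ ≤ (‖u‖ ^ 2 + ‖v‖ ^ 2) / 2 := by nlinarith [sq_nonneg (‖u‖ - ‖v‖)]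
  rw [WithLp.prod_norm_sq_eq_of_L2, e1]
  change _ ≤ _ * (‖u‖ ^ 2 + ‖v‖ ^ 2)
  calc _ ≤ ‖inner ℂ u ((Y * X) u)‖ + ‖inner ℂ u (Y (adjoint Y v))‖ + ‖inner ℂ v (adjoint X (X u))‖
        + ‖inner ℂ v (adjoint X (adjoint Y v))‖ := norm_add₄_le
    _ ≤ numericalRadius (Y * X) * ‖u‖ ^ 2 + ‖Y‖ ^ 2 * (‖u‖ * ‖v‖) + ‖X‖ ^ 2 * (‖u‖ * ‖v‖)
        + numericalRadius (Y * X) * ‖v‖ ^ 2 := by rw [e2]; gcongr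
    _ = numericalRadius (Y * X) * (‖u‖ ^ 2 + ‖v‖ ^ 2) + (‖X‖ ^ 2 + ‖Y‖ ^ 2) * (‖u‖ * ‖v‖) := by ring
    _ ≤ numericalRadius (Y * X) * (‖u‖ ^ 2 + ‖v‖ ^ 2)
        + (‖X‖ ^ 2 + ‖Y‖ ^ 2) * ((‖u‖ ^ 2 + ‖v‖ ^ 2) / 2) := by gcongr
    _ = _ := by ring

theorem numericalRadius_mul_le_add_sq (X Y : H →L[ℂ] H) :
    2 * numericalRadius (X * Y) ≤ numericalRadius (Y * X) + (‖X‖ ^ 2 + ‖Y‖ ^ 2) / 2 := by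
  have h : numericalRadius (X * Y)
      ≤ (numericalRadius (Y * X) + (‖X‖ ^ 2 + ‖Y‖ ^ 2) / 2) / 2 := by
    refine numericalRadius_le_of_norm_add_adjoint_le
      (div_nonneg (add_nonneg (numericalRadius_nonneg _) (by positivity)) zero_le_two)
      fun c hc => ?_
    have := norm_mul_add_adjoint_le (c • X) Y
    rw [smul_mul_assoc, mul_smul_comm, numericalRadius_smul_of_norm_eq_one hc, norm_smul, hc,
      one_mul] at this
    linarith
  linarith

theorem numericalRadius_mul_le (X Y : H →L[ℂ] H) :
    2 * numericalRadius (X * Y) ≤ numericalRadius (Y * X) + ‖X‖ * ‖Y‖ := by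
  have h0 : 0 ≤ numericalRadius (Y * X) + ‖X‖ * ‖Y‖ :=
    add_nonneg (numericalRadius_nonneg _) (by positivity)
  by_cases hXY : X * Y = 0
  · have : numericalRadius (X * Y) ≤ 0 := (numericalRadius_le_norm _).trans (by simp [hXY])
    linarith
  have hX : 0 < ‖X‖ := norm_pos_iff.2 (left_ne_zero_of_mul hXY)
  have hY : 0 < ‖Y‖ := norm_pos_iff.2 (right_ne_zero_of_mul hXY)
  -- With this `s`, `sX` and `s⁻¹Y` have equal norms, so the arithmetic mean of their squares
  -- becomes `‖X‖ ‖Y‖`, while `XY` and `YX` are unchanged.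
  set s : ℝ := √(‖Y‖ / ‖X‖) with hs
  have hs0 : 0 < s := Real.sqrt_pos.2 (by positivity)
  have hs2 : s ^ 2 = ‖Y‖ / ‖X‖ := Real.sq_sqrt (by positivity)
  have hsc : (s : ℂ) ≠ 0 := by exact_mod_cast hs0.ne'
  have h := numericalRadius_mul_le_add_sq ((s : ℂ) • X) ((s : ℂ)⁻¹ • Y)
  rw [smul_mul_smul_comm, smul_mul_smul_comm, mul_inv_cancel₀ hsc, inv_mul_cancel₀ hsc, one_smul,
    one_smul, norm_smul, norm_smul, norm_inv, Complex.norm_real, Real.norm_eq_abs,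
    abs_of_pos hs0, mul_pow, mul_pow, inv_pow, hs2] at h
  refine h.trans_eq ?_
  field_simp
  ring

open ContinuousLinearMap in
theorem numericalRadius_pow_four_le (T : H →L[ℂ] H) :
    16 * numericalRadius T ^ 4 ≤ 4 * numericalRadius (T ^ 2) ^ 2
      + 2 * numericalRadius (T ^ 2 * opP T + opP T * T ^ 2) + ‖opP T‖ ^ 2 := by
  set P := opP T with hP
  set B := T ^ 2 * P + P * T ^ 2 with hB
  set M := 4 * numericalRadius (T ^ 2) ^ 2 + 2 * numericalRadius B + ‖P‖ ^ 2 with hM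
  have hM0 : 0 ≤ M := by
    have := numericalRadius_nonneg B
    positivity
  have hPs : adjoint P = P := by
    change star P = P
    rw [hP, opP]
    simp
  set r := M ^ (1 / 4 : ℝ) with hr
  have hr0 : 0 ≤ r := Real.rpow_nonneg hM0 _
  have hr4 : r ^ 4 = M := by
    rw [hr, ← Real.rpow_natCast, ← Real.rpow_mul hM0]; norm_num
  have key : numericalRadius T ≤ r / 2 := by
    refine numericalRadius_le_of_norm_add_adjoint_le (by positivity) fun c hc => ?_
    rw [mul_div_cancel₀ _ two_ne_zero]
    set D := c • T + adjoint (c • T) with hD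
    set Q := c ^ 2 • T ^ 2 + adjoint (c ^ 2 • T ^ 2) with hQ
    have hcc : c * starRingEnd ℂ c = 1 := by rw [Complex.mul_conj', hc]; simp
    have hDs : adjoint D = D := (isSymmetric_add_adjoint (c • T)).isSelfAdjoint.adjoint_eq
    have hDD : D * D = Q + P := by
      have e1 : adjoint (c • T) = starRingEnd ℂ c • adjoint T := star_smul c T
      have e2 : adjoint (c ^ 2 • T ^ 2) = (starRingEnd ℂ c) ^ 2 • adjoint T ^ 2 := by
        change star _ = _
        rw [star_smul, star_pow, star_pow]; rfl
      rw [hD, hQ, e1, e2, hP, opP, add_mul, mul_add, mul_add, smul_mul_smul_comm,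
        smul_mul_smul_comm, smul_mul_smul_comm, smul_mul_smul_comm, hcc,
        mul_comm (starRingEnd ℂ c) c, hcc, sq, sq, sq, sq, one_smul, one_smul, star_eq_adjoint]
      abel
    have hDDn : ‖D * D‖ ^ 2 ≤ M := by
      have hsq : ‖D * D‖ ≤ √M := by
        refine opNorm_le_bound _ (Real.sqrt_nonneg _) fun x => ?_
        refine le_of_sq_le_sq ?_ (by positivity)
        rw [mul_pow, Real.sq_sqrt hM0, hDD, add_apply, @norm_add_sq ℂ]
        have f1 : ‖Q x‖ ^ 2 ≤ 4 * numericalRadius (T ^ 2) ^ 2 * ‖x‖ ^ 2 := by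
          have g : ‖Q x‖ ≤ 2 * numericalRadius (T ^ 2) * ‖x‖ := by
            refine (Q.le_opNorm x).trans ?_
            gcongr
            refine (norm_add_adjoint_le _).trans_eq ?_
            rw [numericalRadius_smul_of_norm_eq_one (by rw [norm_pow, hc, one_pow])]
          calc ‖Q x‖ ^ 2 ≤ (2 * numericalRadius (T ^ 2) * ‖x‖) ^ 2 := by gcongr
            _ = _ := by ring
        have f2 : ‖P x‖ ^ 2 ≤ ‖P‖ ^ 2 * ‖x‖ ^ 2 := by
          rw [← mul_pow]
          gcongr
          exact P.le_opNorm x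
        -- The adjoint half of `Q` yields `T²P`; the other half, since `P` is self-adjoint, yields
        -- the conjugate of a `PT²` term. The real part ignores the conjugation and merges them into
        -- `B`.
        have f3 : (inner ℂ (Q x) (P x)).re = (c ^ 2 * inner ℂ x (B x)).re := by
          have g1 : inner ℂ (Q x) (P x)
              = starRingEnd ℂ (c ^ 2 * inner ℂ x (P ((T ^ 2) x)))
                + c ^ 2 * inner ℂ x ((T ^ 2) (P x)) := by
            rw [hQ, add_apply, inner_add_left, adjoint_inner_left, smul_apply, smul_apply,
              inner_smul_left, inner_smul_right, map_mul, inner_conj_symm]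
            congr 2
            nth_rw 1 [← hPs]
            rw [adjoint_inner_right]
          rw [g1, hB, Complex.add_re, Complex.conj_re, ← Complex.add_re, ← mul_add,
            add_apply, inner_add_right, add_comm]
          rfl
        have f4 : (inner ℂ (Q x) (P x)).re ≤ numericalRadius B * ‖x‖ ^ 2 := by
          rw [f3]
          refine (Complex.re_le_norm _).trans ?_
          rw [norm_mul, norm_pow, hc, one_pow, one_mul]
          exact norm_inner_apply_le B x
        have f5 : RCLike.re (inner ℂ (Q x) (P x)) = (inner ℂ (Q x) (P x)).re := rfl
        rw [f5, hM]
        nlinarith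
      calc ‖D * D‖ ^ 2 ≤ √M ^ 2 := by gcongr
        _ = M := Real.sq_sqrt hM0
    have hDD2 : ‖D * D‖ = ‖D‖ ^ 2 := by
      have := CStarRing.norm_star_mul_self (x := D)
      rw [star_eq_adjoint, hDs] at this
      rw [this, sq]
    rw [hDD2, ← pow_mul, ← hr4] at hDDn
    exact le_of_pow_le_pow_left₀ (by norm_num) hr0 hDDn
  calc 16 * numericalRadius T ^ 4 ≤ 16 * (r / 2) ^ 4 := by
        have := numericalRadius_nonneg T
        gcongr
    _ = M := by rw [div_pow, hr4]; ring

end Products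

/-! ### Powers of `|T|`, their strong continuity, and the bound by the transform -/

section AbsPow

open Filter Topology

variable {H : Type*} [NormedAddCommGroup H] [InnerProductSpace ℂ H]

theorem IsPartialIsometry.norm_apply_le [CompleteSpace H] {U : H →L[ℂ] H}
    (hU : IsPartialIsometry U) (x : H) : ‖U x‖ ≤ ‖x‖ := by
  have : CompleteSpace (LinearMap.ker U.toLinearMap) := U.isClosed_ker.completeSpace_coe
  obtain ⟨a, ha, b, hb, rfl⟩ :=
    Submodule.exists_add_mem_mem_orthogonal (K := LinearMap.ker U.toLinearMap) x
  have ha' : U a = 0 := ha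
  have hab : inner ℂ a b = 0 := hb a ha
  rw [map_add, ha', zero_add, hU b hb]
  refine le_of_sq_le_sq ?_ (norm_nonneg _)
  rw [sq ‖a + b‖, norm_add_sq_eq_norm_sq_add_norm_sq_of_inner_eq_zero a b hab]
  nlinarith [mul_self_nonneg ‖a‖]

theorem IsPartialIsometry.norm_le_one [CompleteSpace H] {U : H →L[ℂ] H}
    (hU : IsPartialIsometry U) : ‖U‖ ≤ 1 :=
  U.opNorm_le_bound zero_le_one fun x => by rw [one_mul]; exact hU.norm_apply_le x

/-- Expand `‖U*Ux - x‖²`: the cross term is `⟨U*Ux, x⟩ = ‖Ux‖² = ‖x‖²`, and `‖U*Ux‖ ≤ ‖x‖`. -/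
theorem IsPartialIsometry.star_mul_self_apply [CompleteSpace H] {U : H →L[ℂ] H}
    (hU : IsPartialIsometry U) {x : H} (hx : x ∈ (LinearMap.ker U.toLinearMap)ᗮ) :
    (star U * U) x = x := by
  rw [← sub_eq_zero, ← norm_eq_zero, ← sq_eq_zero_iff]
  refine le_antisymm ?_ (sq_nonneg _)
  have h1 : ‖(star U * U) x‖ ≤ ‖x‖ := by
    refine ((star U * U).le_opNorm x).trans ?_
    rw [CStarRing.norm_star_mul_self]
    exact mul_le_of_le_one_left (norm_nonneg _)
      (mul_le_one₀ hU.norm_le_one (norm_nonneg _) hU.norm_le_one)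
  have h2 : inner ℂ ((star U * U) x) x = (‖x‖ : ℂ) ^ 2 := by
    change inner ℂ (ContinuousLinearMap.adjoint U (U x)) x = _
    rw [ContinuousLinearMap.adjoint_inner_left, inner_self_eq_norm_sq_to_K, hU x hx]
    rfl
  rw [@norm_sub_sq ℂ, h2]
  have h3 : RCLike.re ((‖x‖ : ℂ) ^ 2) = ‖x‖ ^ 2 := by
    rw [← Complex.ofReal_pow]; exact Complex.ofReal_re _
  rw [h3]
  have : ‖(star U * U) x‖ ^ 2 ≤ ‖x‖ ^ 2 := by gcongr
  linarith

/-- Under a uniform bound, strong convergence need only be checked on a dense set. -/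
theorem isClosed_setOfPred_tendsto_apply {ι : Type*} {l : Filter ι} {F : ι → H →L[ℂ] H} {C : ℝ}
    (hF : ∀ᶠ i in l, ‖F i‖ ≤ C) (G : H →L[ℂ] H) :
    IsClosed {x | Tendsto (fun i => F i x) l (𝓝 (G x))} := by
  refine isClosed_of_closure_subset fun x hx => ?_
  rw [Set.mem_ofPred_eq, Metric.tendsto_nhds]
  intro ε hε
  set B := |C| + ‖G‖ + 1 with hB
  have hB0 : 0 < B := by positivity
  obtain ⟨y, hy, hxy⟩ := Metric.mem_closure_iff.1 hx (ε / 2 / B) (by positivity)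
  rw [dist_eq_norm, lt_div_iff₀ hB0] at hxy
  filter_upwards [hF, Metric.tendsto_nhds.1 hy (ε / 2) (by positivity)] with i hi hiy
  rw [dist_eq_norm] at hiy ⊢
  have e : F i x - G x = F i (x - y) + (F i y - G y) - G (x - y) := by
    rw [map_sub, map_sub]; abel
  calc ‖F i x - G x‖ ≤ ‖F i (x - y)‖ + ‖F i y - G y‖ + ‖G (x - y)‖ := by
        rw [e]; exact (norm_sub_le _ _).trans (by gcongr; exact norm_add_le _ _)
    _ ≤ |C| * ‖x - y‖ + ‖F i y - G y‖ + ‖G‖ * ‖x - y‖ := by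
        gcongr
        · exact ((F i).le_opNorm _).trans (by gcongr; exact hi.trans (le_abs_self C))
        · exact G.le_opNorm _
    _ ≤ ‖x - y‖ * B + ‖F i y - G y‖ := by rw [hB]; linarith [norm_nonneg (x - y)]
    _ < ε := by linarith

variable [CompleteSpace H]

theorem norm_polarPart_le_one (T : H →L[ℂ] H) : ‖polarPart T‖ ≤ 1 :=
  (isPolarPart_polarPart T).isPartialIsometry.norm_le_one

theorem star_abs (T : H →L[ℂ] H) : star (CFC.abs T) = CFC.abs T :=
  (IsSelfAdjoint.of_nonneg (CFC.abs_nonneg T)).star_eq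

theorem star_polarPart_mul_polarPart_mul_abs (T : H →L[ℂ] H) :
    star (polarPart T) * polarPart T * CFC.abs T = CFC.abs T := by
  have h := isPolarPart_polarPart T
  ext x
  refine h.isPartialIsometry.star_mul_self_apply ?_
  rw [h.ker_eq, ← orthogonal_closure_range_abs]
  exact Submodule.le_orthogonal_orthogonal _ (Submodule.le_topologicalClosure _ ⟨x, rfl⟩)

theorem abs_mul_star_polarPart_mul_polarPart (T : H →L[ℂ] H) :
    CFC.abs T * (star (polarPart T) * polarPart T) = CFC.abs T := by
  have h := congrArg star (star_polarPart_mul_polarPart_mul_abs T)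
  rwa [star_mul, star_mul, star_star, star_abs] at h

theorem abs_rpow_mul_rpow (T : H →L[ℂ] H) {s t : ℝ} (hs : 0 < s) (ht : 0 < t) :
    CFC.abs T ^ s * CFC.abs T ^ t = CFC.abs T ^ (s + t) := by
  lift s to NNReal using hs.le
  lift t to NNReal using ht.le
  rw [NNReal.coe_pos] at hs ht
  rw [← NNReal.coe_add, ← CFC.nnrpow_eq_rpow hs, ← CFC.nnrpow_eq_rpow ht,
    ← CFC.nnrpow_eq_rpow (add_pos hs ht), CFC.nnrpow_add hs ht]

theorem absPow_zero (T : H →L[ℂ] H) : absPow T 0 = star (polarPart T) * polarPart T := if_pos rfl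

theorem absPow_of_ne_zero (T : H →L[ℂ] H) {s : ℝ} (hs : s ≠ 0) : absPow T s = CFC.abs T ^ s :=
  if_neg hs

theorem absPow_one (T : H →L[ℂ] H) : absPow T 1 = CFC.abs T := by
  rw [absPow_of_ne_zero T one_ne_zero, CFC.rpow_one _ (CFC.abs_nonneg T)]

/-- The convention `|T|^0 = U*U` preserves the exponent law at both endpoints, because `U*U` fixes
the range of `|T|`. -/
theorem absPow_mul_absPow_one_sub (T : H →L[ℂ] H) {t : ℝ} (h0 : 0 ≤ t) (h1 : t ≤ 1) :
    absPow T t * absPow T (1 - t) = CFC.abs T := by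
  rcases h0.eq_or_lt with rfl | h0
  · rw [sub_zero, absPow_zero, absPow_one, star_polarPart_mul_polarPart_mul_abs]
  rcases h1.eq_or_lt with rfl | h1
  · rw [sub_self, absPow_zero, absPow_one, abs_mul_star_polarPart_mul_polarPart]
  rw [absPow_of_ne_zero T h0.ne', absPow_of_ne_zero T (sub_pos.2 h1).ne',
    abs_rpow_mul_rpow T h0 (sub_pos.2 h1), add_sub_cancel, CFC.rpow_one _ (CFC.abs_nonneg T)]

theorem norm_absPow_le (T : H →L[ℂ] H) {t : ℝ} (ht : 0 ≤ t) : ‖absPow T t‖ ≤ ‖T‖ ^ t := by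
  rcases ht.eq_or_lt with rfl | ht
  · rw [absPow_zero, CStarRing.norm_star_mul_self, Real.rpow_zero]
    exact mul_le_one₀ (norm_polarPart_le_one T) (norm_nonneg _) (norm_polarPart_le_one T)
  · rw [absPow_of_ne_zero T ht.ne', CFC.norm_rpow _ ht (CFC.abs_nonneg T), CFC.norm_abs]

theorem aluthge_eq_tAluthge (T : H →L[ℂ] H) : aluthge T = tAluthge T (1 / 2) := by
  have h : (1 - 1 / 2 : ℝ) = 1 / 2 := by norm_num
  rw [aluthge, tAluthge, h, absPow_of_ne_zero T (by norm_num)]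

theorem numericalRadius_sq_le (T : H →L[ℂ] H) {t : ℝ} (h0 : 0 ≤ t) (h1 : t ≤ 1) :
    2 * numericalRadius (T ^ 2) ≤ numericalRadius (tAluthge T t ^ 2) + ‖T‖ * ‖tAluthge T t‖ := by
  have h1' : 0 ≤ 1 - t := sub_nonneg.2 h1
  have hcomm : absPow T (1 - t) * absPow T t = CFC.abs T := by
    have := absPow_mul_absPow_one_sub T h1' (sub_le_self 1 h0)
    rwa [sub_sub_cancel] at this
  have hT := (isPolarPart_polarPart T).eq_mul_abs
  have e1 : (polarPart T * absPow T (1 - t)) * (tAluthge T t * absPow T t) = T ^ 2 := by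
    calc _ = polarPart T * (absPow T (1 - t) * absPow T t) * polarPart T
          * (absPow T (1 - t) * absPow T t) := by simp only [tAluthge, mul_assoc]
      _ = (polarPart T * CFC.abs T) * (polarPart T * CFC.abs T) := by
          rw [hcomm]; simp only [mul_assoc]
      _ = T ^ 2 := by rw [← hT, sq]
  have e2 : (tAluthge T t * absPow T t) * (polarPart T * absPow T (1 - t)) = tAluthge T t ^ 2 := by
    simp only [tAluthge, sq, mul_assoc]
  have h := numericalRadius_mul_le (polarPart T * absPow T (1 - t)) (tAluthge T t * absPow T t)
  rw [e1, e2] at h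
  refine h.trans (add_le_add_right ?_ _)
  calc ‖polarPart T * absPow T (1 - t)‖ * ‖tAluthge T t * absPow T t‖
      ≤ (1 * ‖T‖ ^ (1 - t)) * (‖tAluthge T t‖ * ‖T‖ ^ t) := by
        gcongr
        · exact (norm_mul_le _ _).trans (mul_le_mul (norm_polarPart_le_one T)
            (norm_absPow_le T h1') (norm_nonneg _) zero_le_one)
        · exact (norm_mul_le _ _).trans (by gcongr; exact norm_absPow_le T h0)
    _ = (‖T‖ ^ (1 - t) * ‖T‖ ^ t) * ‖tAluthge T t‖ := by ring
    _ = ‖T‖ * ‖tAluthge T t‖ := by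
        -- The exponents sum to `1 ≠ 0`, so the law also covers `‖T‖ = 0`.
        rw [← Real.rpow_add' (norm_nonneg _) (by simp), sub_add_cancel, Real.rpow_one]

theorem numericalRadius_pow_four_le_tAluthge (T : H →L[ℂ] H) {t : ℝ} (h0 : 0 ≤ t) (h1 : t ≤ 1) :
    numericalRadius T ^ 4 ≤
      1 / 16 * (numericalRadius (tAluthge T t ^ 2) + ‖T‖ * ‖tAluthge T t‖) ^ 2
        + 1 / 8 * numericalRadius (T ^ 2 * opP T + opP T * T ^ 2) + 1 / 16 * ‖opP T‖ ^ 2 := by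
  have h2 : (2 * numericalRadius (T ^ 2)) ^ 2
      ≤ (numericalRadius (tAluthge T t ^ 2) + ‖T‖ * ‖tAluthge T t‖) ^ 2 := by
    have := numericalRadius_nonneg (T ^ 2)
    gcongr
    exact numericalRadius_sq_le T h0 h1
  have h3 := numericalRadius_pow_four_le T
  linarith

/-- Halving exponents preserves the kernel, since `‖|T|^s x‖² = ⟨|T|^(2s) x, x⟩`. Any `t > 0`
exceeds some `2⁻ⁿ`, and `|T|^(2⁻ⁿ)` then factors out of `|T|^t` on the right. -/
theorem abs_rpow_apply_eq_zero (T : H →L[ℂ] H) {x : H} (hx : CFC.abs T x = 0) {t : ℝ}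
    (ht : 0 < t) : (CFC.abs T ^ t) x = 0 := by
  have half : ∀ n : ℕ, (CFC.abs T ^ ((1 / 2 : ℝ) ^ n)) x = 0 := by
    intro n
    induction n with
    | zero => rwa [pow_zero, CFC.rpow_one _ (CFC.abs_nonneg T)]
    | succ n ih =>
      set s : ℝ := (1 / 2 : ℝ) ^ (n + 1) with hs
      have hs0 : 0 < s := by positivity
      have hss : (1 / 2 : ℝ) ^ n = s + s := by rw [hs, pow_succ]; ring
      have hsa : ContinuousLinearMap.adjoint (CFC.abs T ^ s) = CFC.abs T ^ s :=
        (IsSelfAdjoint.of_nonneg CFC.rpow_nonneg).adjoint_eq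
      rw [hss, ← abs_rpow_mul_rpow T hs0 hs0] at ih
      rw [← inner_self_eq_zero (𝕜 := ℂ)]
      nth_rw 1 [← hsa]
      rw [ContinuousLinearMap.adjoint_inner_left]
      exact (congrArg (inner ℂ x) ih).trans (inner_zero_right x)
  obtain ⟨n, hn⟩ := exists_pow_lt_of_lt_one ht (by norm_num : (1 / 2 : ℝ) < 1)
  rw [← sub_add_cancel t ((1 / 2 : ℝ) ^ n), ← abs_rpow_mul_rpow T (sub_pos.2 hn) (by positivity)]
  rw [mul_apply_eq_comp, half n, map_zero]

/-- Joint continuity of `x ^ s` for `s > 0` makes the convergence uniform on the compact spectrum.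
At exponent `0` norm continuity fails if the spectrum accumulates at `0`; only strong continuity
survives there. -/
theorem continuousAt_abs_rpow (T : H →L[ℂ] H) {t : ℝ} (ht : 0 < t) :
    ContinuousAt (fun s : ℝ => CFC.abs T ^ s) t := by
  refine continuousAt_cfc_fun (f := fun (s : ℝ) (x : NNReal) => x ^ s) ?_ ?_
  · have hcomp : IsCompact (spectrum NNReal (CFC.abs T)) :=
      ContinuousFunctionalCalculus.isCompact_spectrum _
    intro u hu
    have hf : ContinuousOn (Function.uncurry fun (s : ℝ) (x : NNReal) => x ^ s)
        (Set.Ioi 0 ×ˢ spectrum NNReal (CFC.abs T)) := by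
      rintro ⟨s, x⟩ ⟨hs, -⟩
      have : ContinuousAt (fun p : NNReal × ℝ => p.1 ^ p.2) (x, s) :=
        NNReal.continuousAt_rpow (Or.inr hs)
      exact (ContinuousAt.comp (f := Prod.swap) (x := (s, x)) this
        continuous_swap.continuousAt).continuousWithinAt
    obtain ⟨v, hv, hvu⟩ := hcomp.mem_uniformity_of_prod hf (Set.mem_Ioi.2 ht)
      (symm_le_uniformity hu)
    rw [(isOpen_Ioi).nhdsWithin_eq (Set.mem_Ioi.2 ht)] at hv
    filter_upwards [hv] with s hs x hx using hvu s hs x hx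
  · filter_upwards [lt_mem_nhds ht] with s hs
    exact (NNReal.continuous_rpow_const hs.le).continuousOn

/-- Split along the closure of the range of `|T|` and its complement `ker T`. On `ker T` everything
vanishes. On the range, `|T|^t (|T|y) = |T|^(t+1) y → |T|y` by norm continuity at exponent `1`, and
the uniform bound extends this to the closure. -/
theorem tendsto_absPow_apply_zero (T : H →L[ℂ] H) (x : H) :
    Tendsto (fun t => absPow T t x) (𝓝[>] 0) (𝓝 (absPow T 0 x)) := by
  set K := (LinearMap.range (CFC.abs T).toLinearMap).topologicalClosure with hK
  have : CompleteSpace K := (Submodule.isClosed_topologicalClosure _).completeSpace_coe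
  obtain ⟨a, ha, b, hb, rfl⟩ := Submodule.exists_add_mem_mem_orthogonal (K := K) x
  have hbT : T b = 0 := by
    rw [hK, orthogonal_closure_range_abs] at hb
    exact hb
  simp only [map_add]
  refine Tendsto.add ?_ ?_
  · obtain ⟨C, hC⟩ : ∃ C : ℝ, ∀ᶠ t : ℝ in 𝓝[>] 0, ‖absPow T t‖ ≤ C := by
      refine ⟨max 1 ‖T‖, ?_⟩
      filter_upwards [Ioo_mem_nhdsGT (zero_lt_one' ℝ)] with t ht
      refine (norm_absPow_le T ht.1.le).trans ?_
      calc ‖T‖ ^ t ≤ (max 1 ‖T‖) ^ t := by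
            have := ht.1.le
            gcongr
            exact le_max_right _ _
        _ ≤ max 1 ‖T‖ := Real.rpow_le_self_of_one_le (le_max_left _ _) ht.2.le
    have hcl : IsClosed {y | Tendsto (fun t => absPow T t y) (𝓝[>] 0) (𝓝 (absPow T 0 y))} :=
      isClosed_setOfPred_tendsto_apply hC _
    have ha' : a ∈ closure (LinearMap.range (CFC.abs T).toLinearMap : Set H) := by
      rw [← Submodule.topologicalClosure_coe]; exact ha
    refine closure_minimal ?_ hcl ha'
    rintro _ ⟨y, rfl⟩
    have h1 : Tendsto (fun t : ℝ => CFC.abs T ^ (t + 1)) (𝓝[>] 0) (𝓝 (CFC.abs T ^ (0 + 1 : ℝ))) := by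
      have hg : ContinuousAt (fun t : ℝ => t + 1) 0 := (continuous_add_const 1).continuousAt
      exact ((continuousAt_abs_rpow T (by norm_num : (0 : ℝ) < 0 + 1)).comp
        (f := fun t : ℝ => t + 1) hg).tendsto.mono_left nhdsWithin_le_nhds
    rw [zero_add, CFC.rpow_one _ (CFC.abs_nonneg T)] at h1
    have h2 : Tendsto (fun t : ℝ => (CFC.abs T ^ (t + 1)) y) (𝓝[>] 0) (𝓝 (CFC.abs T y)) :=
      ((ContinuousLinearMap.apply ℂ H y).continuous.tendsto _).comp h1
    have h3 : absPow T 0 (CFC.abs T y) = CFC.abs T y := by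
      rw [absPow_zero, ← mul_apply_eq_comp, star_polarPart_mul_polarPart_mul_abs]
    change Tendsto (fun t => absPow T t (CFC.abs T y)) _ (𝓝 (absPow T 0 (CFC.abs T y)))
    rw [h3]
    refine h2.congr' ?_
    filter_upwards [self_mem_nhdsWithin] with t ht
    rw [absPow_of_ne_zero T (ne_of_gt ht), ← abs_rpow_mul_rpow T ht one_pos,
      CFC.rpow_one _ (CFC.abs_nonneg T), mul_apply_eq_comp]
  · have h0 : absPow T 0 b = 0 := by
      have hU : polarPart T b = 0 := by
        have : b ∈ LinearMap.ker (polarPart T).toLinearMap := by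
          rw [(isPolarPart_polarPart T).ker_eq]; exact hbT
        exact this
      rw [absPow_zero]
      rw [mul_apply_eq_comp, hU, map_zero]
    rw [h0]
    refine tendsto_const_nhds.congr' ?_
    filter_upwards [self_mem_nhdsWithin] with t ht
    have habs : CFC.abs T b = 0 := by rw [← norm_eq_zero, norm_abs_apply, hbT, norm_zero]
    rw [absPow_of_ne_zero T (ne_of_gt ht), abs_rpow_apply_eq_zero T habs ht]

end AbsPow

/-! ### Lower semicontinuity and attainment of the minimum -/

section Semicontinuity

open Filter Topology

variable {H : Type*} [NormedAddCommGroup H] [InnerProductSpace ℂ H]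
  {α : Type*} [TopologicalSpace α] {F G : α → H →L[ℂ] H} {s : Set α}

theorem continuousOn_apply_apply (hF : ∀ x, ContinuousOn (fun t => F t x) s)
    (hG : ∀ x, ContinuousOn (fun t => G t x) s) {C : ℝ} (hC : ∀ t ∈ s, ‖F t‖ ≤ C) (x : H) :
    ContinuousOn (fun t => (F t * G t) x) s := by
  intro t ht
  have h1 : Tendsto (fun u => ‖G u x - G t x‖) (𝓝[s] t) (𝓝 0) := by
    simpa using ((hG x t ht).tendsto.sub_const (G t x)).norm
  have h2 : Tendsto (fun u => F u (G u x - G t x)) (𝓝[s] t) (𝓝 0) := by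
    refine squeeze_zero_norm' ?_ (by simpa using h1.const_mul C)
    filter_upwards [self_mem_nhdsWithin] with u hu
    exact ((F u).le_opNorm _).trans (by gcongr; exact hC u hu)
  have h3 := h2.add (hF (G t x) t ht).tendsto
  simp only [map_sub, sub_add_cancel, zero_add] at h3
  exact h3

theorem lowerSemicontinuousOn_norm (hF : ∀ x, ContinuousOn (fun t => F t x) s) :
    LowerSemicontinuousOn (fun t => ‖F t‖) s := by
  intro t ht y hy
  obtain ⟨x, hx, hyx⟩ := (F t).exists_lt_apply_of_lt_opNorm hy
  filter_upwards [(hF x t ht).norm.eventually (lt_mem_nhds hyx)] with u hu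
  exact hu.trans_le (((F u).le_opNorm x).trans (mul_le_of_le_one_right (norm_nonneg _) hx.le))

theorem lowerSemicontinuousOn_numericalRadius (hF : ∀ x, ContinuousOn (fun t => F t x) s) :
    LowerSemicontinuousOn (fun t => numericalRadius (F t)) s := by
  intro t ht y hy
  -- A negative `y` is split off because a near-maximising unit vector need not exist when the space
  -- is zero.
  rcases lt_or_ge y 0 with hy0 | hy0
  · exact Eventually.of_forall fun u => hy0.trans_le (numericalRadius_nonneg _)
  obtain ⟨x, hx, hyx⟩ : ∃ x, ‖x‖ = 1 ∧ y < ‖inner ℂ x (F t x)‖ := by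
    by_contra! hcon
    exact absurd hy (not_lt.2 (numericalRadius_le hy0 hcon))
  have hc : ContinuousWithinAt (fun u => ‖inner ℂ x (F u x)‖) s t :=
    (ContinuousWithinAt.inner (𝕜 := ℂ) continuousWithinAt_const (hF x t ht)).norm
  filter_upwards [hc.eventually (lt_mem_nhds hyx)] with u hu
  exact hu.trans_le (norm_inner_apply_le_of_norm_eq_one _ hx)

variable [CompleteSpace H]

theorem continuousOn_absPow_apply (T : H →L[ℂ] H) (x : H) :
    ContinuousOn (fun t => absPow T t x) (Set.Ici 0) := by
  intro t ht
  rcases (Set.mem_Ici.1 ht).eq_or_lt with rfl | ht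
  · rw [← continuousWithinAt_Ioi_iff_Ici]
    exact tendsto_absPow_apply_zero T x
  · have h1 : ContinuousAt (fun s : ℝ => (CFC.abs T ^ s) x) t :=
      ((ContinuousLinearMap.apply ℂ H x).continuous.continuousAt).comp (continuousAt_abs_rpow T ht)
    refine (h1.congr ?_).continuousWithinAt
    filter_upwards [lt_mem_nhds ht] with s hs
    rw [absPow_of_ne_zero T hs.ne']

theorem norm_absPow_le_max (T : H →L[ℂ] H) {t : ℝ} (ht : t ∈ Set.Icc (0 : ℝ) 1) :
    ‖absPow T t‖ ≤ max 1 ‖T‖ := by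
  have h0 := ht.1
  refine (norm_absPow_le T h0).trans ?_
  calc ‖T‖ ^ t ≤ (max 1 ‖T‖) ^ t := by
        gcongr
        exact le_max_right _ _
    _ ≤ max 1 ‖T‖ := Real.rpow_le_self_of_one_le (le_max_left _ _) ht.2

theorem norm_tAluthge_le (T : H →L[ℂ] H) {t : ℝ} (ht : t ∈ Set.Icc (0 : ℝ) 1) :
    ‖tAluthge T t‖ ≤ max 1 ‖T‖ * 1 * max 1 ‖T‖ := by
  refine (norm_mul_le _ _).trans (mul_le_mul ((norm_mul_le _ _).trans ?_)
    (norm_absPow_le_max T ⟨sub_nonneg.2 ht.2, sub_le_self 1 ht.1⟩) (norm_nonneg _) (by positivity))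
  gcongr
  · exact norm_absPow_le_max T ht
  · exact norm_polarPart_le_one T

theorem continuousOn_tAluthge_apply (T : H →L[ℂ] H) (x : H) :
    ContinuousOn (fun t => tAluthge T t x) (Set.Icc 0 1) := by
  have h1 : ∀ x, ContinuousOn (fun t => absPow T t x) (Set.Icc 0 1) := fun x =>
    (continuousOn_absPow_apply T x).mono Set.Icc_subset_Ici_self
  have h2 : ∀ x, ContinuousOn (fun t => absPow T (1 - t) x) (Set.Icc 0 1) := fun x =>
    (continuousOn_absPow_apply T x).comp (by fun_prop) fun t ht => sub_nonneg.2 ht.2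
  simp only [tAluthge, mul_assoc]
  exact continuousOn_apply_apply h1
    (G := fun t => polarPart T * absPow T (1 - t))
    (fun x => (polarPart T).continuous.comp_continuousOn (h2 x))
    (fun t ht => norm_absPow_le_max T ht) x

theorem exists_isLeast_aluthgeValues (T : H →L[ℂ] H) : ∃ m, IsLeast (aluthgeValues T) m := by
  have h1 := continuousOn_tAluthge_apply T
  have h2 : ∀ x, ContinuousOn (fun t => (tAluthge T t ^ 2) x) (Set.Icc 0 1) := fun x => by
    simp only [sq]
    exact continuousOn_apply_apply h1 h1 (fun t ht => norm_tAluthge_le T ht) x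
  have h3 : LowerSemicontinuousOn
      (fun t => numericalRadius (tAluthge T t ^ 2) + ‖T‖ * ‖tAluthge T t‖) (Set.Icc 0 1) :=
    (lowerSemicontinuousOn_numericalRadius h2).add
      ((continuous_const_mul ‖T‖).comp_lowerSemicontinuousOn (lowerSemicontinuousOn_norm h1)
        fun a b hab => mul_le_mul_of_nonneg_left hab (norm_nonneg T))
  obtain ⟨t, ht, hmin⟩ := h3.exists_isMinOn ⟨0, by simp⟩ isCompact_Icc
  refine ⟨_, ⟨t, ht, rfl⟩, ?_⟩
  rintro _ ⟨u, hu, rfl⟩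
  have := numericalRadius_nonneg (tAluthge T t ^ 2)
  exact pow_le_pow_left₀ (by positivity) (hmin hu) 2

end Semicontinuity

/-! ### The 3 × 3 example -/

section Example

open Matrix

theorem sqrt_mul_sqrt_ofReal {a : ℝ} (ha : 0 ≤ a) : ((√a : ℝ) : ℂ) * (√a : ℝ) = a := by
  rw [← Complex.ofReal_mul, Real.mul_self_sqrt ha]

theorem diagonal_sqrt_mul_self :
    (diagonal ![0, ((√2 : ℝ) : ℂ), ((√3 : ℝ) : ℂ)]) * diagonal ![0, ((√2 : ℝ) : ℂ), ((√3 : ℝ) : ℂ)]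
      = diagonal ![0, 2, 3] := by
  rw [diagonal_mul_diagonal]
  congr 1
  ext i
  have h2 := sqrt_mul_sqrt_ofReal (zero_le_two (α := ℝ))
  have h3 := sqrt_mul_sqrt_ofReal (zero_le_three (α := ℝ))
  fin_cases i <;> simp_all

theorem toEuclideanCLM_diagonal_nonneg {d : Fin 3 → ℝ} (hd : ∀ i, 0 ≤ d i) :
    0 ≤ toEuclideanCLM (n := Fin 3) (𝕜 := ℂ) (diagonal fun i => (d i : ℂ)) := by
  have h : toEuclideanCLM (n := Fin 3) (𝕜 := ℂ) (diagonal fun i => (d i : ℂ))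
      = star (toEuclideanCLM (n := Fin 3) (𝕜 := ℂ) (diagonal fun i => ((√(d i) : ℝ) : ℂ)))
        * toEuclideanCLM (n := Fin 3) (𝕜 := ℂ) (diagonal fun i => ((√(d i) : ℝ) : ℂ)) := by
    rw [← map_star, ← map_mul, star_eq_conjTranspose, diagonal_conjTranspose, diagonal_mul_diagonal]
    congr 2
    ext i
    simp [sqrt_mul_sqrt_ofReal (hd i)]
  rw [h]
  exact star_mul_self_nonneg _

theorem star_exampleOp :
    star exampleOp = toEuclideanCLM (n := Fin 3) (𝕜 := ℂ) !![0, 0, 0; 2, 0, 0; 0, 3, 0] := by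
  rw [exampleOp, ← map_star, star_eq_conjTranspose]
  congr 1
  ext i j
  fin_cases i <;> fin_cases j <;> simp [Matrix.conjTranspose_apply]

theorem abs_exampleOp :
    CFC.abs exampleOp = toEuclideanCLM (n := Fin 3) (𝕜 := ℂ) (diagonal ![0, 2, 3]) := by
  have hnn := toEuclideanCLM_diagonal_nonneg (d := ![0, 2, 3])
    (by intro i; fin_cases i <;> norm_num)
  have hd : (fun i => ((![0, 2, 3] i : ℝ) : ℂ)) = (![0, 2, 3] : Fin 3 → ℂ) := by
    ext i; fin_cases i <;> simp
  rw [hd] at hnn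
  refine CFC.sqrt_unique ?_ hnn
  rw [star_exampleOp, exampleOp, ← map_mul, ← map_mul]
  congr 1
  ext i j
  fin_cases i <;> fin_cases j <;> norm_num [diagonal_apply]

theorem abs_exampleOp_rpow_half :
    CFC.abs exampleOp ^ (1 / 2 : ℝ) = toEuclideanCLM (n := Fin 3) (𝕜 := ℂ)
      (diagonal ![0, ((√2 : ℝ) : ℂ), ((√3 : ℝ) : ℂ)]) := by
  have hnn := toEuclideanCLM_diagonal_nonneg (d := ![0, √2, √3])
    (by intro i; fin_cases i <;> simp)
  have hd : (fun i => ((![0, √2, √3] i : ℝ) : ℂ)) = ![0, ((√2 : ℝ) : ℂ), ((√3 : ℝ) : ℂ)] := by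
    ext i; fin_cases i <;> simp
  rw [hd] at hnn
  rw [← CFC.sqrt_eq_rpow]
  refine CFC.sqrt_unique ?_ hnn
  rw [abs_exampleOp, ← map_mul, diagonal_sqrt_mul_self]

/-- With `Q` the projection onto `(ker T)ᗮ`, `T = U|T|` determines `UQ` because `Q = |T| diag(0,
1/2, 1/3)`, and `ker U = ker T` forces `U(1 - Q) = 0`. -/
theorem polarPart_exampleOp : polarPart exampleOp
    = toEuclideanCLM (n := Fin 3) (𝕜 := ℂ) !![0, 1, 0; 0, 0, 1; 0, 0, 0] := by
  have h := isPolarPart_polarPart exampleOp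
  set U := polarPart exampleOp
  set Q := toEuclideanCLM (n := Fin 3) (𝕜 := ℂ) (diagonal ![0, 1, 1]) with hQ
  have h1 : U * Q = toEuclideanCLM (n := Fin 3) (𝕜 := ℂ) !![0, 1, 0; 0, 0, 1; 0, 0, 0] := by
    have e1 : Q = CFC.abs exampleOp
        * toEuclideanCLM (n := Fin 3) (𝕜 := ℂ) (diagonal ![0, 1 / 2, 1 / 3]) := by
      rw [abs_exampleOp, hQ, ← map_mul, diagonal_mul_diagonal]
      congr 2
      ext i
      fin_cases i <;> simp
    rw [e1, ← mul_assoc, ← h.eq_mul_abs, exampleOp, ← map_mul]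
    congr 1
    ext i j
    fin_cases i <;> fin_cases j <;> simp
  have h2 : exampleOp * (1 - Q) = 0 := by
    rw [hQ, exampleOp, ← map_one (toEuclideanCLM (n := Fin 3) (𝕜 := ℂ)), ← map_sub, ← map_mul,
      ← map_zero (toEuclideanCLM (n := Fin 3) (𝕜 := ℂ))]
    congr 1
    ext i j
    fin_cases i <;> fin_cases j <;>
      simp [Matrix.mul_apply, Fin.sum_univ_three, diagonal_apply, Matrix.one_apply]
  have h3 : U * (1 - Q) = 0 := by
    ext1 x
    have : (1 - Q) x ∈ LinearMap.ker U.toLinearMap := by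
      rw [h.ker_eq]
      exact DFunLike.congr_fun h2 x
    exact this
  rw [← h1]
  rwa [mul_sub, mul_one, sub_eq_zero] at h3

theorem tAluthge_exampleOp_one : tAluthge exampleOp 1
    = toEuclideanCLM (n := Fin 3) (𝕜 := ℂ) !![0, 0, 0; 0, 0, 2; 0, 0, 0] := by
  rw [tAluthge, sub_self, absPow_one, absPow_zero, abs_exampleOp, polarPart_exampleOp,
    ← map_star, ← map_mul, ← map_mul, ← map_mul]
  congr 1
  ext i j
  fin_cases i <;> fin_cases j <;>
    simp [Matrix.mul_apply, Fin.sum_univ_three, star_eq_conjTranspose, diagonal_apply]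

theorem aluthge_exampleOp : aluthge exampleOp
    = toEuclideanCLM (n := Fin 3) (𝕜 := ℂ)
        !![0, 0, 0; 0, 0, ((√2 : ℝ) : ℂ) * ((√3 : ℝ) : ℂ); 0, 0, 0] := by
  rw [aluthge, abs_exampleOp_rpow_half, polarPart_exampleOp, ← map_mul, ← map_mul]
  congr 1
  ext i j
  fin_cases i <;> fin_cases j <;> simp [Matrix.mul_apply, diagonal_apply]

theorem opP_exampleOp : opP exampleOp
    = toEuclideanCLM (n := Fin 3) (𝕜 := ℂ) (diagonal ![4, 13, 9]) := by
  rw [opP, star_exampleOp, exampleOp, ← map_mul (toEuclideanCLM (n := Fin 3) (𝕜 := ℂ)),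
    ← map_mul (toEuclideanCLM (n := Fin 3) (𝕜 := ℂ)), ← map_add]
  congr 1
  ext i j
  fin_cases i <;> fin_cases j <;> norm_num [diagonal_apply]

theorem sq_mul_opP_add_exampleOp :
    exampleOp ^ 2 * opP exampleOp + opP exampleOp * exampleOp ^ 2
      = toEuclideanCLM (n := Fin 3) (𝕜 := ℂ) !![0, 0, 78; 0, 0, 0; 0, 0, 0] := by
  rw [opP_exampleOp, exampleOp, ← map_pow, ← map_mul, ← map_mul, ← map_add]
  congr 1
  ext i j
  fin_cases i <;> fin_cases j <;>
    norm_num [Matrix.mul_apply, Fin.sum_univ_three, sq, Matrix.vecMul_diagonal, diagonal_apply]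

theorem norm_toEuclideanCLM_le {A : Matrix (Fin 3) (Fin 3) ℂ} {M : ℝ} (hM : 0 ≤ M)
    (h : ∀ x : Fin 3 → ℂ, ‖(A *ᵥ x) 0‖ ^ 2 + ‖(A *ᵥ x) 1‖ ^ 2 + ‖(A *ᵥ x) 2‖ ^ 2
      ≤ M ^ 2 * (‖x 0‖ ^ 2 + ‖x 1‖ ^ 2 + ‖x 2‖ ^ 2)) :
    ‖toEuclideanCLM (n := Fin 3) (𝕜 := ℂ) A‖ ≤ M := by
  refine ContinuousLinearMap.opNorm_le_bound _ hM fun x => ?_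
  refine le_of_sq_le_sq ?_ (by positivity)
  rw [mul_pow, EuclideanSpace.norm_sq_eq, EuclideanSpace.norm_sq_eq, Fin.sum_univ_three,
    Fin.sum_univ_three, ofLp_toEuclideanCLM]
  exact h x.ofLp

theorem norm_exampleOp : ‖exampleOp‖ = 3 := by
  refine le_antisymm (norm_toEuclideanCLM_le (by norm_num) fun x => ?_) ?_
  · simp [Matrix.mulVec, dotProduct, Fin.sum_univ_three, mul_pow]
    nlinarith [sq_nonneg ‖x 0‖, sq_nonneg ‖x 1‖]
  · have h := exampleOp.le_opNorm (EuclideanSpace.single 2 1)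
    have e : ‖exampleOp (EuclideanSpace.single 2 1)‖ ^ 2 = 3 ^ 2 := by
      rw [EuclideanSpace.norm_sq_eq, exampleOp, ofLp_toEuclideanCLM]
      simp [Fin.sum_univ_three]
    rw [(pow_left_inj₀ (norm_nonneg _) (by norm_num) two_ne_zero).1 e] at h
    simpa using h

theorem norm_tAluthge_exampleOp_one_le : ‖tAluthge exampleOp 1‖ ≤ 2 := by
  rw [tAluthge_exampleOp_one]
  refine norm_toEuclideanCLM_le (by norm_num) fun x => ?_
  simp [Matrix.mulVec, dotProduct, Fin.sum_univ_three, mul_pow]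
  nlinarith [sq_nonneg ‖x 0‖, sq_nonneg ‖x 1‖]

theorem norm_opP_exampleOp_le : ‖opP exampleOp‖ ≤ 13 := by
  rw [opP_exampleOp]
  refine norm_toEuclideanCLM_le (by norm_num) fun x => ?_
  simp [Matrix.mulVec_diagonal, mul_pow]
  nlinarith [sq_nonneg ‖x 0‖, sq_nonneg ‖x 2‖]

theorem tAluthge_exampleOp_one_sq : tAluthge exampleOp 1 ^ 2 = 0 := by
  rw [tAluthge_exampleOp_one, ← map_pow, ← map_zero (toEuclideanCLM (n := Fin 3) (𝕜 := ℂ))]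
  congr 1
  ext i j
  fin_cases i <;> fin_cases j <;> simp [Matrix.mul_apply, Fin.sum_univ_three, sq]

theorem numericalRadius_sq_mul_opP_add_exampleOp_le :
    numericalRadius (exampleOp ^ 2 * opP exampleOp + opP exampleOp * exampleOp ^ 2) ≤ 39 := by
  rw [sq_mul_opP_add_exampleOp]
  refine numericalRadius_le (by norm_num) fun x hx => ?_
  have h1 : ‖x 0‖ ^ 2 + ‖x 1‖ ^ 2 + ‖x 2‖ ^ 2 = 1 := by
    rw [← Fin.sum_univ_three (fun i => ‖x i‖ ^ 2), ← EuclideanSpace.norm_sq_eq, hx, one_pow]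
  rw [PiLp.inner_apply, ofLp_toEuclideanCLM]
  simp [Fin.sum_univ_three, Matrix.mulVec, dotProduct]
  nlinarith [sq_nonneg (‖x 0‖ - ‖x 2‖), sq_nonneg ‖x 1‖]

theorem le_numericalRadius_aluthge_exampleOp :
    6 / 5 ≤ numericalRadius (aluthge exampleOp) := by
  -- This vector has squared norm `2` and gives `√6 ≤ 2w`.
  have h := norm_inner_apply_le (aluthge exampleOp) !₂[0, 1, 1]
  generalize numericalRadius (aluthge exampleOp) = w at h ⊢
  rw [aluthge_exampleOp, PiLp.inner_apply, ofLp_toEuclideanCLM, EuclideanSpace.norm_sq_eq] at h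
  simp [Fin.sum_univ_three, abs_of_nonneg] at h
  rw [← Real.sqrt_mul zero_le_two] at h
  have h6 : (12 / 5 : ℝ) ≤ √(2 * 3) := Real.le_sqrt_of_sq_le (by norm_num)
  have h2 := h6.trans h
  linarith

theorem exampleOp_bound_lt {m : ℝ} (hm : IsLeast (aluthgeValues exampleOp) m) :
    (1 / 16 * m
        + 1 / 8 * numericalRadius (exampleOp ^ 2 * opP exampleOp + opP exampleOp * exampleOp ^ 2)
        + 1 / 16 * ‖opP exampleOp‖ ^ 2) ^ (1 / 4 : ℝ)
      < 1 / 2 * (‖exampleOp‖ + numericalRadius (aluthge exampleOp)) := by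
  have hm0 : 0 ≤ m := by
    obtain ⟨t, -, rfl⟩ := hm.1
    positivity
  -- At `t = 1` the transform squares to zero and has norm at most `2`.
  have hm36 : m ≤ 36 := by
    refine (hm.2 ⟨1, by simp, rfl⟩).trans ?_
    have hw : numericalRadius (tAluthge exampleOp 1 ^ 2) = 0 := by
      refine le_antisymm ?_ (numericalRadius_nonneg _)
      rw [tAluthge_exampleOp_one_sq]
      exact (numericalRadius_le_norm _).trans_eq norm_zero
    simp only [hw, norm_exampleOp, zero_add]
    calc (3 * ‖tAluthge exampleOp 1‖) ^ 2 ≤ (3 * 2) ^ 2 := by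
          gcongr
          exact norm_tAluthge_exampleOp_one_le
      _ = 36 := by norm_num
  have hw0 := numericalRadius_nonneg
    (exampleOp ^ 2 * opP exampleOp + opP exampleOp * exampleOp ^ 2)
  have hw := numericalRadius_sq_mul_opP_add_exampleOp_le
  have hP : ‖opP exampleOp‖ ^ 2 ≤ 13 ^ 2 := by
    gcongr
    exact norm_opP_exampleOp_le
  have hA := le_numericalRadius_aluthge_exampleOp
  rw [norm_exampleOp]
  -- The separator is `(3 + 6/5)/2 = 21/10`. The quantity under the fourth root is at most `(36 + 78
  -- + 169)/16 = 17.6875`, below `(21/10)⁴ = 19.4481`.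
  refine lt_of_lt_of_le (b := (21 / 10 : ℝ)) ?_ (by linarith)
  have h4 : (21 / 10 : ℝ) = ((21 / 10 : ℝ) ^ 4) ^ (1 / 4 : ℝ) := by
    rw [← Real.rpow_natCast, ← Real.rpow_mul (by norm_num)]
    norm_num
  rw [h4]
  refine Real.rpow_lt_rpow (by positivity) ?_ (by norm_num)
  norm_num at hP ⊢
  linarith

end Example

end NumRadius

theorem mainTheorem4 :
    -- the bound, for every bounded operator on a complex Hilbert space; the minimum is attained
    (∀ (H : Type*) [NormedAddCommGroup H] [InnerProductSpace ℂ H] [CompleteSpace H]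
        (T : H →L[ℂ] H),
      (∃ m : ℝ, IsLeast (NumRadius.aluthgeValues T) m ∧
        NumRadius.numericalRadius T ^ 4 ≤
          1 / 16 * m
            + 1 / 8 * NumRadius.numericalRadius
                (T ^ 2 * NumRadius.opP T + NumRadius.opP T * T ^ 2)
            + 1 / 16 * ‖NumRadius.opP T‖ ^ 2) ∧
      NumRadius.numericalRadius T ^ 4 ≤
        1 / 16 * (NumRadius.numericalRadius (NumRadius.aluthge T ^ 2)
            + ‖T‖ * ‖NumRadius.aluthge T‖) ^ 2
          + 1 / 8 * NumRadius.numericalRadius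
              (T ^ 2 * NumRadius.opP T + NumRadius.opP T * T ^ 2)
          + 1 / 16 * ‖NumRadius.opP T‖ ^ 2) ∧
    -- an operator for which the bound is strictly smaller than `(‖T‖ + w(T̃)) / 2`
    (∃ m : ℝ, IsLeast (NumRadius.aluthgeValues NumRadius.exampleOp) m ∧
      (1 / 16 * m
          + 1 / 8 * NumRadius.numericalRadius
              (NumRadius.exampleOp ^ 2 * NumRadius.opP NumRadius.exampleOp
                + NumRadius.opP NumRadius.exampleOp * NumRadius.exampleOp ^ 2)
          + 1 / 16 * ‖NumRadius.opP NumRadius.exampleOp‖ ^ 2) ^ (1 / 4 : ℝ) <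
        1 / 2 * (‖NumRadius.exampleOp‖
          + NumRadius.numericalRadius (NumRadius.aluthge NumRadius.exampleOp))) := by
  refine ⟨fun H _ _ _ T => ⟨?_, ?_⟩, ?_⟩
  · obtain ⟨m, hm⟩ := NumRadius.exists_isLeast_aluthgeValues T
    refine ⟨m, hm, ?_⟩
    obtain ⟨t, ht, rfl⟩ := hm.1
    exact NumRadius.numericalRadius_pow_four_le_tAluthge T ht.1 ht.2
  · rw [NumRadius.aluthge_eq_tAluthge]
    exact NumRadius.numericalRadius_pow_four_le_tAluthge T (by norm_num) (by norm_num)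
  · obtain ⟨m, hm⟩ := NumRadius.exists_isLeast_aluthgeValues NumRadius.exampleOp
    exact ⟨m, hm, NumRadius.exampleOp_bound_lt hm⟩
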